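/- Let $n\ge 0$ be an integer and $\beta\in\mathbb{R}$. Let $\mathcal{H}^n$ denote the $n$-dimensional Hausdorff measure on $\mathbb{R}^{n+1}$ (normalized so that it agrees with Lebesgue measure on $n$-dimensional planes), let $|\cdot|$ be the Euclidean norm, and let $B_1=\{x\in\mathbb{R}^{n+1}:|x|<1\}$. 1. If $\beta>n$, there exists a constant $C_1<\infty$ depending only on $n$ and $\beta$ such that for every open convex set $\Omega\subset\mathbb{R}^{n+1}$ $$\int_{\partial\Omega\setminus B_1}|x|^{-\beta}\,d\mathcal{H}^n(x)\le C_1 .$$ 2. If $\beta<n$, there exists a constant $C_2<\infty$ depending only on $n$ and $\beta$ such that for every open convex set $\Omega\subset\mathbb{R}^{n+1}$ $$\int_{\partial\Omega\cap B_1}|x|^{-\beta}\,d\mathcal{H}^n(x)\le C_2 .$$ -/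

import Mathlib

open MeasureTheory
open scoped ENNReal NNReal

/-!
The boundary of a convex set has area at most `C r ^ n` in the ball of radius `r`, with `C`
depending only on `n`; a dyadic decomposition then does the rest.

For the area bound (`euclideanHausdorffMeasure_frontier_inter_ball_le`), attach to each boundary
point `x` in the ball of radius `r` an outer normal `v`, and follow the ray from `x` in direction `v`
until it meets the boundary of the cube `[-r, r]ⁿ⁺¹`, at `y`. As outer normals of a convex set are
monotone, `dist x x' ≤ dist y y'` (this is the fact that the nearest-point projection, which sends
`y` back to `x`, is 1-Lipschitz). Hence the area in question is at most that of the boundary of the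
cube, `2 (n + 1) (2 r) ^ n`.

On the annulus `r ≤ ‖x‖ ≤ 2 r` the weight `‖x‖ ^ (-β)` is at most `2 ^ |β| r ^ (-β)`, so the integral
over it is at most a constant times `r ^ (n - β)` (`lintegral_frontier_annulus_le`). Summing over
dyadic radii gives a geometric series, convergent for radii going to infinity if `n < β` and for
radii going to zero if `β < n` (`lintegral_frontier_iUnion_annuli_le`). The origin, which no annulus
contains, contributes zero.
-/

/-! ### Outer normals of convex sets -/

section ConvexBoundary

variable {E : Type*} [NormedAddCommGroup E] [InnerProductSpace ℝ E]

/-- An open convex set has a supporting hyperplane at each of its boundary points. -/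
theorem exists_outer_normal_of_mem_frontier [CompleteSpace E] {Ω : Set E} (ho : IsOpen Ω)
    (hc : Convex ℝ Ω) {x : E} (hx : x ∈ frontier Ω) :
    ∃ v : E, v ≠ 0 ∧ ∀ z ∈ closure Ω, inner ℝ v (z - x) ≤ 0 := by
  have hxΩ : x ∉ Ω := fun h => by
    rw [ho.frontier_eq] at hx
    exact hx.2 h
  obtain ⟨f, hf⟩ := geometric_hahn_banach_open_point hc ho hxΩ
  refine ⟨(InnerProductSpace.toDual ℝ E).symm f, ?_, fun z hz => ?_⟩
  · intro h0
    have hf0 : f = 0 := by simpa using h0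
    obtain ⟨a, ha⟩ := closure_nonempty_iff.1 ⟨x, frontier_subset_closure hx⟩
    simpa [hf0] using hf a ha
  · rw [InnerProductSpace.toDual_symm_apply, map_sub, sub_nonpos]
    have hcl : IsClosed {w | f w ≤ f x} := isClosed_le f.continuous continuous_const
    exact closure_minimal (fun a ha => (hf a ha).le) hcl hz

/-- Moving two points of a convex set along outer normals does not bring them closer: the displacement
`x - x'` pairs nonnegatively with `t • v - t' • v'`. -/
theorem dist_le_dist_add_smul_of_outer_normal {x x' v v' : E} {t t' : ℝ} (ht : 0 ≤ t)
    (ht' : 0 ≤ t') (h : inner ℝ v (x' - x) ≤ 0) (h' : inner ℝ v' (x - x') ≤ 0) :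
    dist x x' ≤ dist (x + t • v) (x' + t' • v') := by
  rw [dist_eq_norm, dist_eq_norm]
  have key : ‖x - x'‖ * ‖x - x'‖ ≤ ‖x + t • v - (x' + t' • v')‖ * ‖x - x'‖ := by
    refine le_trans ?_ (real_inner_le_norm _ _)
    have e : x + t • v - (x' + t' • v') = (x - x') + t • v - t' • v' := by abel
    have h1 : inner ℝ v (x - x') = -inner ℝ v (x' - x) := by
      rw [← inner_neg_right, neg_sub]
    rw [e, inner_sub_left, inner_add_left, real_inner_smul_left, real_inner_smul_left,
      real_inner_self_eq_norm_mul_norm, h1]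
    nlinarith [mul_nonneg ht (neg_nonneg.2 h), mul_nonneg ht' (neg_nonneg.2 h')]
  rcases (norm_nonneg (x - x')).eq_or_lt with h0 | h0
  · rw [← h0]
    positivity
  · exact le_of_mul_le_mul_right key h0

end ConvexBoundary

/-! ### Surface area of a convex boundary inside a ball -/

/-- The boundary of the cube `[-r, r]ᵐ`, for `r ≥ 0`: all coordinates are at most `r` in absolute
value, and one of them attains it. -/
def cubeBoundary (m : ℕ) (r : ℝ) : Set (EuclideanSpace ℝ (Fin m)) :=
  {y | (∃ i, |y i| = r) ∧ ∀ j, |y j| ≤ r}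

/-- A ray issued from a point of the ball of radius `r` meets the boundary of the cube
`[-r, r]ᵐ`. -/
theorem exists_add_smul_mem_cubeBoundary {m : ℕ} {r : ℝ} {x v : EuclideanSpace ℝ (Fin m)}
    (hv : v ≠ 0) (hx : ‖x‖ < r) : ∃ t : ℝ, 0 ≤ t ∧ x + t • v ∈ cubeBoundary m r := by
  have hr : 0 < r := (norm_nonneg x).trans_lt hx
  -- `g` is the sup norm along the ray; the point sought is where it takes the value `r`.
  let g : ℝ → ℝ := fun t => ‖(x + t • v).ofLp‖
  have hg : Continuous g := by fun_prop
  have hg0 : g 0 < r := by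
    refine lt_of_le_of_lt ?_ hx
    simp only [g, zero_smul, add_zero]
    exact (pi_norm_le_iff_of_nonneg (norm_nonneg x)).2 fun i => PiLp.norm_apply_le x i
  obtain ⟨k, hk⟩ : ∃ k, v k ≠ 0 := by
    by_contra! h
    exact hv (by ext i; simpa using h i)
  have hk' : 0 < |v k| := abs_pos.2 hk
  obtain ⟨T, hT, hgT⟩ : ∃ T, 0 ≤ T ∧ r ≤ g T := by
    -- At this time the `k`-th coordinate has moved by `2 * r`, from a position in `(-r, r)`.
    refine ⟨2 * r / |v k|, by positivity, ?_⟩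
    have h1 : ‖(x + (2 * r / |v k|) • v).ofLp k‖ ≤ g (2 * r / |v k|) := norm_le_pi_norm _ k
    have h2 : |x k| < r := (PiLp.norm_apply_le x k).trans_lt hx
    have h3 : |2 * r / |v k| * v k| = 2 * r := by
      rw [abs_mul, abs_div, abs_abs, abs_of_pos (by positivity : 0 < 2 * r)]
      field_simp
    have h4 := abs_sub_abs_le_abs_sub (2 * r / |v k| * v k) (-x k)
    rw [abs_neg, sub_neg_eq_add, h3] at h4
    simp only [PiLp.add_apply, PiLp.smul_apply, smul_eq_mul, Real.norm_eq_abs] at h1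
    rw [add_comm] at h1
    linarith
  obtain ⟨t, ht, hgt⟩ := intermediate_value_Icc hT hg.continuousOn ⟨hg0.le, hgT⟩
  refine ⟨t, ht.1, ?_, fun j => ?_⟩
  · by_contra! h
    have : g t < r := (pi_norm_lt_iff hr).2 fun i =>
      lt_of_le_of_ne ((norm_le_pi_norm _ i).trans hgt.le) (h i)
    exact this.ne hgt
  · exact (norm_le_pi_norm _ j).trans hgt.le

theorem isometry_insertNth {n : ℕ} (i : Fin (n + 1)) (s : ℝ) :
    Isometry fun z : EuclideanSpace ℝ (Fin n) =>
      (WithLp.toLp 2 (i.insertNth s z.ofLp) : EuclideanSpace ℝ (Fin (n + 1))) := by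
  refine Isometry.of_dist_eq fun z w => ?_
  rw [EuclideanSpace.dist_eq, EuclideanSpace.dist_eq, Fin.sum_univ_succAbove _ i]
  simp

theorem euclideanHausdorffMeasure_cube (n : ℕ) {r : ℝ} (hr : 0 ≤ r) :
    Measure.euclideanHausdorffMeasure n {z : EuclideanSpace ℝ (Fin n) | ∀ j, |z j| ≤ r} =
      ENNReal.ofReal ((2 * r) ^ n) := by
  have h : {z : EuclideanSpace ℝ (Fin n) | ∀ j, |z j| ≤ r} =
      (fun z => z.ofLp) ⁻¹' Metric.closedBall (0 : Fin n → ℝ) r := by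
    ext z
    simp [pi_norm_le_iff_of_nonneg hr]
  rw [EuclideanSpace.euclideanHausdorffMeasure_eq_volume, h,
    (PiLp.volume_preserving_ofLp (Fin n)).measure_preimage
      Metric.isClosed_closedBall.measurableSet.nullMeasurableSet,
    Real.volume_pi_closedBall _ hr, Fintype.card_fin]

/-- The boundary of the cube consists of `2 * (n + 1)` isometric copies of `[-r, r]ⁿ`. -/
theorem euclideanHausdorffMeasure_cubeBoundary_le (n : ℕ) {r : ℝ} (hr : 0 ≤ r) :
    Measure.euclideanHausdorffMeasure n (cubeBoundary (n + 1) r) ≤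
      ENNReal.ofReal (2 * (n + 1) * (2 * r) ^ n) := by
  let F : Fin (n + 1) → ℝ → EuclideanSpace ℝ (Fin n) → EuclideanSpace ℝ (Fin (n + 1)) :=
    fun i s z => WithLp.toLp 2 (i.insertNth s z.ofLp)
  let Q : Set (EuclideanSpace ℝ (Fin n)) := {z | ∀ j, |z j| ≤ r}
  have hF : ∀ i s, Measure.euclideanHausdorffMeasure n (F i s '' Q) =
      ENNReal.ofReal ((2 * r) ^ n) := fun i s => by
    rw [(isometry_insertNth i s).euclideanHausdorffMeasure_image,
      euclideanHausdorffMeasure_cube n hr]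
  have hsub : cubeBoundary (n + 1) r ⊆ ⋃ i, (F i r '' Q ∪ F i (-r) '' Q) := by
    rintro y ⟨⟨i, hi⟩, hy⟩
    have hmem : y ∈ F i (y i) '' Q := by
      refine ⟨WithLp.toLp 2 (i.removeNth y.ofLp), fun j => hy _, ?_⟩
      simp only [F, Fin.insertNth_self_removeNth]
    refine Set.mem_iUnion.2 ⟨i, ?_⟩
    rcases eq_or_eq_neg_of_abs_eq hi with h | h <;> rw [h] at hmem
    exacts [Or.inl hmem, Or.inr hmem]
  calc _ ≤ ∑ i : Fin (n + 1),
        Measure.euclideanHausdorffMeasure n (F i r '' Q ∪ F i (-r) '' Q) :=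
        (measure_mono hsub).trans (measure_iUnion_fintype_le _ _)
    _ ≤ ∑ _i : Fin (n + 1), ENNReal.ofReal (2 * (2 * r) ^ n) := by
        refine Finset.sum_le_sum fun i _ => (measure_union_le _ _).trans ?_
        rw [hF, hF, ← ENNReal.ofReal_add (by positivity) (by positivity), ← two_mul]
    _ = _ := by
        rw [Finset.sum_const, Finset.card_univ, Fintype.card_fin, ← ENNReal.ofReal_nsmul]
        congr 1
        simp
        ring

theorem AntilipschitzWith.le_euclideanHausdorffMeasure_image {X Y : Type*} [EMetricSpace X]
    [EMetricSpace Y] [MeasurableSpace X] [BorelSpace X] [MeasurableSpace Y] [BorelSpace Y]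
    {f : X → Y} (hf : AntilipschitzWith 1 f) (d : ℕ) (s : Set X) :
    Measure.euclideanHausdorffMeasure d s ≤ Measure.euclideanHausdorffMeasure d (f '' s) := by
  simp only [Measure.euclideanHausdorffMeasure_def, Measure.smul_apply]
  have := hf.le_hausdorffMeasure_image (Nat.cast_nonneg d) s
  rw [ENNReal.coe_one, ENNReal.one_rpow, one_mul] at this
  gcongr

/-- Area bound, uniform over convex sets: sending each boundary point in the ball to a point of the
cube boundary on its normal ray does not decrease distances, so the area of this part of the
boundary is at most that of the cube. -/
theorem euclideanHausdorffMeasure_frontier_inter_ball_le {n : ℕ}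
    {Ω : Set (EuclideanSpace ℝ (Fin (n + 1)))} (ho : IsOpen Ω) (hc : Convex ℝ Ω)
    {r : ℝ} (hr : 0 ≤ r) :
    Measure.euclideanHausdorffMeasure n (frontier Ω ∩ Metric.ball 0 r) ≤
      ENNReal.ofReal (2 * (n + 1) * (2 * r) ^ n) := by
  set A := frontier Ω ∩ Metric.ball 0 r
  have hpick : ∀ x : A, ∃ (v : EuclideanSpace ℝ (Fin (n + 1))) (t : ℝ),
      (∀ z ∈ closure Ω, inner ℝ v (z - x) ≤ 0) ∧ 0 ≤ t ∧
        (x : EuclideanSpace ℝ (Fin (n + 1))) + t • v ∈ cubeBoundary (n + 1) r := by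
    rintro ⟨x, hx, hxr⟩
    obtain ⟨v, hv, hvx⟩ := exists_outer_normal_of_mem_frontier ho hc hx
    obtain ⟨t, ht, hxt⟩ := exists_add_smul_mem_cubeBoundary hv (mem_ball_zero_iff.1 hxr)
    exact ⟨v, t, hvx, ht, hxt⟩
  choose v t hv ht hmem using hpick
  let f : A → EuclideanSpace ℝ (Fin (n + 1)) := fun x => x + t x • v x
  have hf : AntilipschitzWith 1 f := AntilipschitzWith.of_le_mul_dist fun x y => by
    rw [NNReal.coe_one, one_mul]
    exact dist_le_dist_add_smul_of_outer_normal (ht x) (ht y)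
      (hv x y (frontier_subset_closure y.2.1)) (hv y x (frontier_subset_closure x.2.1))
  have hA : A = ((↑) : A → EuclideanSpace ℝ (Fin (n + 1))) '' Set.univ := by simp
  rw [hA, isometry_subtype_coe.euclideanHausdorffMeasure_image]
  refine (hf.le_euclideanHausdorffMeasure_image n _).trans ((measure_mono ?_).trans
    (euclideanHausdorffMeasure_cubeBoundary_le n hr))
  rintro _ ⟨x, -, rfl⟩
  exact hmem x

/-! ### Dyadic decomposition of the weighted integral -/

theorem rpow_neg_le_of_mem_Icc {r s : ℝ} (β : ℝ) (hr : 0 < r) (h1 : r ≤ s) (h2 : s ≤ 2 * r) :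
    s ^ (-β) ≤ 2 ^ |β| * r ^ (-β) := by
  have hs : 0 < s := hr.trans_le h1
  have hq : 1 ≤ s / r := (one_le_div hr).2 h1
  have e : s ^ (-β) = (s / r) ^ (-β) * r ^ (-β) := by
    rw [← Real.mul_rpow (by positivity) hr.le, div_mul_cancel₀ _ hr.ne']
  rw [e]
  gcongr
  calc (s / r) ^ (-β) ≤ (s / r) ^ |β| := Real.rpow_le_rpow_of_exponent_le hq (neg_le_abs β)
    _ ≤ 2 ^ |β| := by
      gcongr
      exact (div_le_iff₀ hr).2 h2

theorem lintegral_frontier_annulus_le {n : ℕ} (β : ℝ)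
    {Ω : Set (EuclideanSpace ℝ (Fin (n + 1)))} (ho : IsOpen Ω) (hc : Convex ℝ Ω)
    {r : ℝ} (hr : 0 < r) :
    ∫⁻ x in frontier Ω ∩ {x | r ≤ ‖x‖ ∧ ‖x‖ ≤ 2 * r}, ‖x‖ₑ ^ (-β)
        ∂(Measure.euclideanHausdorffMeasure n) ≤
      ENNReal.ofReal (2 ^ |β| * (2 * (n + 1)) * 6 ^ n * r ^ ((n : ℝ) - β)) := by
  have hm : MeasurableSet (frontier Ω ∩ {x | r ≤ ‖x‖ ∧ ‖x‖ ≤ 2 * r}) :=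
    (isClosed_frontier.inter ((isClosed_le continuous_const continuous_norm).inter
      (isClosed_le continuous_norm continuous_const))).measurableSet
  calc _ ≤ ∫⁻ x in frontier Ω ∩ {x | r ≤ ‖x‖ ∧ ‖x‖ ≤ 2 * r},
          ENNReal.ofReal (2 ^ |β| * r ^ (-β)) ∂(Measure.euclideanHausdorffMeasure n) := by
        refine setLIntegral_mono' hm fun x hx => ?_
        rw [← ofReal_norm, ENNReal.ofReal_rpow_of_pos (hr.trans_le hx.2.1)]
        exact ENNReal.ofReal_le_ofReal (rpow_neg_le_of_mem_Icc β hr hx.2.1 hx.2.2)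
    -- The closed annulus lies in the open ball of radius `3 * r`.
    _ ≤ ENNReal.ofReal (2 ^ |β| * r ^ (-β)) *
          ENNReal.ofReal (2 * (n + 1) * (2 * (3 * r)) ^ n) := by
        rw [setLIntegral_const]
        gcongr
        refine (measure_mono ?_).trans
          (euclideanHausdorffMeasure_frontier_inter_ball_le ho hc (by positivity : 0 ≤ 3 * r))
        rintro x ⟨hx, -, hx2⟩
        exact ⟨hx, mem_ball_zero_iff.2 (by linarith)⟩
    _ = _ := by
        rw [← ENNReal.ofReal_mul (by positivity)]
        congr 1
        rw [sub_eq_add_neg, Real.rpow_add hr, Real.rpow_natCast, ← mul_assoc 2 3 r, mul_pow]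
        norm_num
        ring

/-- Summation over the annuli `s * q ^ k ≤ ‖x‖ ≤ 2 * (s * q ^ k)`: their contributions form a
geometric series of ratio `q ^ (n - β)`. The ratio `q = 2` serves the exterior of the unit ball and
`q = 1 / 2` its interior. -/
theorem lintegral_frontier_iUnion_annuli_le {n : ℕ} (β : ℝ) {q : ℝ} (hq : 0 < q)
    (hq1 : q ^ ((n : ℝ) - β) < 1) {s : ℝ} (hs : 0 < s) :
    ∃ C : ℝ≥0, ∀ Ω : Set (EuclideanSpace ℝ (Fin (n + 1))), IsOpen Ω → Convex ℝ Ω →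
      ∀ S ⊆ frontier Ω, (∀ x ∈ S, ∃ k : ℕ, s * q ^ k ≤ ‖x‖ ∧ ‖x‖ ≤ 2 * (s * q ^ k)) →
        ∫⁻ x in S, ‖x‖ₑ ^ (-β) ∂(Measure.euclideanHausdorffMeasure n) ≤ (C : ℝ≥0∞) := by
  let b : ℕ → ℝ := fun k =>
    2 ^ |β| * (2 * ((n : ℝ) + 1)) * 6 ^ n * (s * q ^ k) ^ ((n : ℝ) - β)
  have hb0 : ∀ k, 0 ≤ b k := fun k => by positivity
  have hb : Summable b := by
    refine Summable.mul_left _ ?_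
    have e : ∀ k : ℕ, (s * q ^ k) ^ ((n : ℝ) - β) =
        s ^ ((n : ℝ) - β) * (q ^ ((n : ℝ) - β)) ^ k := fun k => by
      rw [Real.mul_rpow hs.le (by positivity), ← Real.rpow_natCast q k, ← Real.rpow_mul hq.le,
        mul_comm (k : ℝ), Real.rpow_mul hq.le, Real.rpow_natCast]
    simp_rw [e]
    exact (summable_geometric_of_lt_one (by positivity) hq1).mul_left _
  refine ⟨(∑' k, b k).toNNReal, fun Ω ho hc S hS hcov => ?_⟩
  have hsub : S ⊆ ⋃ k : ℕ,
      frontier Ω ∩ {x | s * q ^ k ≤ ‖x‖ ∧ ‖x‖ ≤ 2 * (s * q ^ k)} := fun x hx =>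
    let ⟨k, hk⟩ := hcov x hx
    Set.mem_iUnion.2 ⟨k, hS hx, hk⟩
  calc _ ≤ ∑' k : ℕ, ∫⁻ x in frontier Ω ∩ {x | s * q ^ k ≤ ‖x‖ ∧ ‖x‖ ≤ 2 * (s * q ^ k)},
          ‖x‖ₑ ^ (-β) ∂(Measure.euclideanHausdorffMeasure n) :=
        (lintegral_mono_set hsub).trans (lintegral_iUnion_le _ _)
    _ ≤ ∑' k : ℕ, ENNReal.ofReal (b k) :=
        ENNReal.tsum_le_tsum fun k => lintegral_frontier_annulus_le β ho hc (by positivity)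
    _ = _ := (ENNReal.ofReal_tsum_of_nonneg hb0 hb).symm

/-- The origin does not contribute. For `0 < n` it is a null set, whatever the value `0 ^ (-β)`; for
`n = 0` it has mass one, but then `β < 0` and the integrand vanishes there. -/
theorem setLIntegral_singleton_zero_enorm_rpow_eq_zero {n : ℕ} {β : ℝ} (hβ : β < n) :
    ∫⁻ x in ({0} : Set (EuclideanSpace ℝ (Fin (n + 1)))), ‖x‖ₑ ^ (-β)
      ∂(Measure.euclideanHausdorffMeasure n) = 0 := by
  rw [lintegral_singleton]
  rcases n.eq_zero_or_pos with rfl | hn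
  · rw [enorm_zero, ENNReal.zero_rpow_of_pos (by simpa using hβ), zero_mul]
  · have := Measure.nullSingletonClass_hausdorff (EuclideanSpace ℝ (Fin (n + 1)))
      (Nat.cast_pos.2 hn : (0 : ℝ) < n)
    rw [Measure.euclideanHausdorffMeasure_def, Measure.smul_apply, measure_singleton, smul_zero,
      mul_zero]

theorem lemma4p1 (n : ℕ) (β : ℝ) :
    ((n : ℝ) < β → ∃ C₁ : ℝ≥0, ∀ Ω : Set (EuclideanSpace ℝ (Fin (n + 1))),
      IsOpen Ω → Convex ℝ Ω →
        ∫⁻ x in frontier Ω \ Metric.ball 0 1, ‖x‖ₑ ^ (-β)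
          ∂(Measure.euclideanHausdorffMeasure n) ≤ (C₁ : ℝ≥0∞)) ∧
    (β < (n : ℝ) → ∃ C₂ : ℝ≥0, ∀ Ω : Set (EuclideanSpace ℝ (Fin (n + 1))),
      IsOpen Ω → Convex ℝ Ω →
        ∫⁻ x in frontier Ω ∩ Metric.ball 0 1, ‖x‖ₑ ^ (-β)
          ∂(Measure.euclideanHausdorffMeasure n) ≤ (C₂ : ℝ≥0∞)) := by
  constructor
  · intro hβ
    obtain ⟨C, hC⟩ := lintegral_frontier_iUnion_annuli_le (n := n) β (q := 2) two_pos
      (Real.rpow_lt_one_of_one_lt_of_neg one_lt_two (sub_neg.2 hβ)) one_pos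
    refine ⟨C, fun Ω ho hc => hC Ω ho hc _ Set.sdiff_subset fun x hx => ?_⟩
    have hx1 : 1 ≤ ‖x‖ := not_lt.1 fun h => hx.2 (mem_ball_zero_iff.2 h)
    obtain ⟨k, hk, hk'⟩ := exists_nat_pow_near hx1 one_lt_two
    refine ⟨k, by rwa [one_mul], ?_⟩
    rw [one_mul, ← pow_succ']
    exact hk'.le
  · intro hβ
    obtain ⟨C, hC⟩ := lintegral_frontier_iUnion_annuli_le (n := n) β (q := 1 / 2) (by norm_num)
      (Real.rpow_lt_one (by norm_num) (by norm_num) (sub_pos.2 hβ)) (s := 1 / 2) (by norm_num)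
    refine ⟨C, fun Ω ho hc => ?_⟩
    -- The dyadic annuli cover the ball only away from the origin.
    have hsub : frontier Ω ∩ Metric.ball 0 1 ⊆ {0} ∪ ((frontier Ω ∩ Metric.ball 0 1) \ {0}) :=
      fun x hx => by
        rw [Set.union_sdiff_self]
        exact Or.inr hx
    refine (lintegral_mono_set hsub).trans ((lintegral_union_le _ _ _).trans ?_)
    rw [setLIntegral_singleton_zero_enorm_rpow_eq_zero hβ, zero_add]
    refine hC Ω ho hc _ (Set.sdiff_subset.trans Set.inter_subset_left) fun x hx => ?_
    obtain ⟨k, hk, hk'⟩ := exists_nat_pow_near_of_lt_one (norm_pos_iff.2 hx.2)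
      (mem_ball_zero_iff.1 hx.1.2).le (by norm_num : (0 : ℝ) < 1 / 2) (by norm_num)
    refine ⟨k, ?_, ?_⟩
    · rw [← pow_succ']
      exact hk.le
    · rwa [← mul_assoc, mul_one_div_cancel two_ne_zero, one_mul]
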